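/- Let $\mu\in\mathbb{R}\setminus\{0\}$ and $\sigma>0$, and let $X(t)=\exp(\mu t+\sigma B(t))$, $t\ge 0$, be geometric Brownian motion, where $B$ is a standard Brownian motion on a probability space $(\Omega,\mathcal F,\mathbb P)$; thus $\log X(t)\sim\mathcal N(\mu t,\sigma^2t)$. For amounts $c_0,c_1,\dots$ invested at times $0=t_0<t_1<\cdots$ put $X_k=X(t_k)/X(t_{k-1})$, let the wealth be $Y_1=c_0X_1$, $Y_k=X_k\,(Y_{k-1}+c_{k-1})$ for $k\ge2$, and let the return at time $t_k$ be $R_k=\big(\sum_{j=0}^{k-1}c_j\big)^{-1}Y_k$. For $n\ge1$ let $\mathcal R_n$ denote the return at time $t_n=1$ when $c_k=\frac1n$ and $t_k=\frac kn$ (dollar cost averaging in $n$ equal steps). Then for every $x\in\mathbb{R}$ the limit $\lim_{n\to\infty}\mathbb P(\mathcal R_n\le x)$ exists and equals $\mathbb P\big(\int_0^1X(s)\,ds\le x\big)$ (so $\mathcal R_n$ converges in distribution to integrated geometric Brownian motion), and $$\mathbb P(Z\le x)\ \ge\ \lim_{n\to\infty}\mathbb P(\mathcal R_n\le x),$$ where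 $Z$ is a positive random variable (on any probability space) with $$\log Z\sim\mathcal N\Big(\log\frac{e^\mu-1}{\mu},\ \sigma^2\cdot\frac{(2\mu-3)e^{2\mu}+4e^\mu-1}{2\mu(e^\mu-1)^2}\Big),$$ the stated variance being strictly positive. -/

import Mathlib

open MeasureTheory ProbabilityTheory Filter Topology
open scoped NNReal

noncomputable section

/-- `X` is geometric Brownian motion with `X 0 = 1` almost surely and
`log X(t) ∼ N(μ t, σ² t)`, that is `X(t) = exp (μ t + σ B(t))` for a standard Brownian motion `B`
(with almost surely continuous paths). -/
def IsGeometricBrownianMotion {Ω : Type*} [MeasurableSpace Ω] (X : ℝ≥0 → Ω → ℝ) (μ σ : ℝ)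
    (P : Measure Ω) : Prop :=
  ∃ B : ℝ≥0 → Ω → ℝ, IsBrownianReal B P ∧
    ∀ t ω, X t ω = Real.exp (μ * (t : ℝ) + σ * B t ω)

/-- The wealth `Y k` at time `t k` when the amount `c j` is invested at time `t j` in an asset with
price process `X`: with `X_k = X (t k) / X (t (k - 1))`, `Y 1 = c 0 * X_1` and
`Y k = X_k * (Y (k - 1) + c (k - 1))`. The convention `Y 0 = 0` (wealth just before
the first investment) makes the two clauses one. -/
def wealth {Ω : Type*} (X : ℝ≥0 → Ω → ℝ) (c : ℕ → ℝ) (t : ℕ → ℝ≥0) : ℕ → Ω → ℝ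
  | 0, _ => 0
  | k + 1, ω => X (t (k + 1)) ω / X (t k) ω * (wealth X c t k ω + c k)

/-- The return at time `t k`: the wealth divided by the total amount invested before time `t k`. -/
def returns {Ω : Type*} (X : ℝ≥0 → Ω → ℝ) (c : ℕ → ℝ) (t : ℕ → ℝ≥0) (k : ℕ) (ω : Ω) : ℝ :=
  (∑ j ∈ Finset.range k, c j)⁻¹ * wealth X c t k ω

/-- The return at time `1 = n / n` of dollar cost averaging in `n` steps: the amount `1 / n` is
invested at each of the times `k / n`, `k = 0, …, n - 1`. (Only these values of the schedule enter,
together with the final time `n / n`; the value at `n = 0` is irrelevant.) -/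
def dcaReturn {Ω : Type*} (X : ℝ≥0 → Ω → ℝ) (n : ℕ) : Ω → ℝ :=
  returns X (fun _ => 1 / (n : ℝ)) (fun k => (k : ℝ≥0) / (n : ℝ≥0)) n

/-- `∫₀¹ X(s) ds`, path by path. -/
def integratedProcess {Ω : Type*} (X : ℝ≥0 → Ω → ℝ) (ω : Ω) : ℝ :=
  ∫ s in (0 : ℝ)..1, X s.toNNReal ω

/-- The log-mean of the lognormal comparison variable. -/
def boundLogMean (μ : ℝ) : ℝ := Real.log ((Real.exp μ - 1) / μ)

/-- The log-variance of the lognormal comparison variable. -/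
def boundLogVariance (μ σ : ℝ) : ℝ :=
  σ ^ 2 * (((2 * μ - 3) * Real.exp (2 * μ) + 4 * Real.exp μ - 1) /
    (2 * μ * (Real.exp μ - 1) ^ 2))

end

/-!
Unfolding the recursion, the return of dollar cost averaging in `n` steps is
`n⁻¹ ∑ X 1 / X (j / n)`, `0 ≤ j < n`. This is the right Riemann sum
`averagedPrice` of `exp (μ t + σ b t)` along the reversed noise `b t = B 1 - B (1 - t)`
(`dcaReturn_eq_averagedPrice`). The reversed noise has the finite-dimensional distributions of
Brownian motion (`IsPreBrownianReal.timeReversal`), so the return has the law of the Riemann sum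
`S n` along `B` itself, and `S n` converges almost surely to `∫₀¹ X`.

Almost sure convergence gives convergence of the distribution functions at every `x` because the
limit has no atoms (`measure_integral_price_eq_zero`): the bridge `B t - t B 1`, `t ≤ 1`, is
independent of `B 1`, and for a fixed bridge path `∫₀¹ X` is strictly increasing in `B 1`, so by
Fubini each value is attained with probability zero.

For the inequality, write `S n` as its noiseless value times a weighted mean of the
`exp (σ B (k / n))`, with weights proportional to `exp (μ k / n)`. By Jensen's inequality `S n`
dominates a lognormal variable (`exp_le_averagedPrice`). Its log-variance is a mean square of tail
sums of the weights (`IsPreBrownianReal.hasLaw_sum_grid`). These tails are ratios of geometric sums,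
so the log-variance is exactly a Riemann sum of the square of
`σ (exp μ - exp (μ u)) / (exp μ - 1)`, whose integral over `[0, 1]` is `boundLogVariance μ σ`
(`integral_sq_expTail`); in particular the latter is positive. Likewise the log-mean tends
to `boundLogMean μ`, and Gaussian distribution functions are continuous in their parameters, so the
bound passes to the limit.
-/

/-! ### Riemann sums and limits of distribution functions -/

/-- Riemann sums of a continuous function over the uniform partitions of `[0, 1]`, with arbitrary
tags, converge to its integral. -/
lemma tendsto_riemannSum {f : ℝ → ℝ} (hf : Continuous f) (ξ : ℕ → ℕ → ℝ)
    (hξ : ∀ n k : ℕ, k < n → ξ n k ∈ Set.Icc ((k : ℝ) / n) (((k + 1 : ℕ) : ℝ) / n)) :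
    Tendsto (fun n : ℕ => (n : ℝ)⁻¹ * ∑ k ∈ Finset.range n, f (ξ n k)) atTop
      (𝓝 (∫ s in (0 : ℝ)..1, f s)) := by
  have huc : UniformContinuousOn f (Set.Icc 0 1) :=
    isCompact_Icc.uniformContinuousOn_of_continuous hf.continuousOn
  rw [Metric.tendsto_atTop]
  intro ε hε
  obtain ⟨δ, hδ, hfδ⟩ := Metric.uniformContinuousOn_iff.1 huc (ε / 2) (half_pos hε)
  obtain ⟨N, hN⟩ := exists_nat_one_div_lt hδ
  refine ⟨N + 1, fun n hn => ?_⟩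
  have hn0 : (0 : ℝ) < n := by exact_mod_cast (by omega : 0 < n)
  have hnδ : (1 : ℝ) / n < δ :=
    lt_of_le_of_lt (one_div_le_one_div_of_le (by positivity) (by exact_mod_cast hn)) hN
  have hsplit : ∫ s in (0 : ℝ)..1, f s
      = ∑ k ∈ Finset.range n, ∫ s in ((k : ℝ) / n)..(((k + 1 : ℕ) : ℝ) / n), f s := by
    rw [intervalIntegral.sum_integral_adjacent_intervals (a := fun k : ℕ => (k : ℝ) / n)
      fun k _ => hf.intervalIntegrable _ _]
    simp [hn0.ne']
  have hlen (k : ℕ) : ((k + 1 : ℕ) : ℝ) / n - (k : ℝ) / n = (n : ℝ)⁻¹ := by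
    push_cast; field_simp; ring
  have hterm : ∀ k ∈ Finset.range n,
      |(n : ℝ)⁻¹ * f (ξ n k) - ∫ s in ((k : ℝ) / n)..(((k + 1 : ℕ) : ℝ) / n), f s|
        ≤ ε / 2 * (n : ℝ)⁻¹ := by
    intro k hk
    have hkn : k < n := Finset.mem_range.1 hk
    have hle : (k : ℝ) / n ≤ ((k + 1 : ℕ) : ℝ) / n := by
      have := hlen k
      have := inv_pos.2 hn0
      linarith
    have hsub : Set.Icc ((k : ℝ) / n) (((k + 1 : ℕ) : ℝ) / n) ⊆ Set.Icc 0 1 :=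
      Set.Icc_subset_Icc (by positivity) ((div_le_one hn0).2 (by exact_mod_cast hkn))
    have hconst : (n : ℝ)⁻¹ * f (ξ n k)
        = ∫ s in ((k : ℝ) / n)..(((k + 1 : ℕ) : ℝ) / n), f (ξ n k) := by
      rw [intervalIntegral.integral_const, hlen, smul_eq_mul]
    rw [hconst, ← intervalIntegral.integral_sub (continuous_const.intervalIntegrable _ _)
      (hf.intervalIntegrable _ _), ← Real.norm_eq_abs]
    have hbound := intervalIntegral.norm_integral_le_of_norm_le_const
      (f := fun s => f (ξ n k) - f s) (a := (k : ℝ) / n) (b := ((k + 1 : ℕ) : ℝ) / n)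
      (C := ε / 2) ?_
    · rwa [hlen, abs_of_pos (inv_pos.2 hn0)] at hbound
    · intro s hs
      rw [Set.uIoc_of_le hle] at hs
      have hs' := Set.Ioc_subset_Icc_self hs
      have hξ' := hξ n k hkn
      have hdist : dist (ξ n k) s < δ := by
        refine lt_of_le_of_lt (Real.dist_le_of_mem_Icc hξ' hs') ?_
        rw [hlen, ← one_div]
        exact hnδ
      exact (hfδ _ (hsub hξ') _ (hsub hs') hdist).le
  rw [Real.dist_eq, hsplit, Finset.mul_sum, ← Finset.sum_sub_distrib]
  calc _ ≤ ∑ k ∈ Finset.range n, ε / 2 * (n : ℝ)⁻¹ :=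
        (Finset.abs_sum_le_sum_abs _ _).trans (Finset.sum_le_sum hterm)
    _ = ε / 2 := by simp; field_simp
    _ < ε := half_lt_self hε

/-- If `f n → g` almost surely and the law of `g` has no atom at `x`, then the distribution functions
of the `f n` converge at `x` to that of `g`. -/
lemma tendsto_measureReal_le_of_ae_tendsto {Ω : Type*} [MeasurableSpace Ω] {P : Measure Ω}
    [IsFiniteMeasure P] {f : ℕ → Ω → ℝ} {g : Ω → ℝ} (hf : ∀ n, AEMeasurable (f n) P)
    (hlim : ∀ᵐ ω ∂P, Tendsto (fun n => f n ω) atTop (𝓝 (g ω))) {x : ℝ}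
    (hx : P {ω | g ω = x} = 0) :
    Tendsto (fun n => P.real {ω | f n ω ≤ x}) atTop (𝓝 (P.real {ω | g ω ≤ x})) := by
  have hg : AEMeasurable g P := aemeasurable_of_tendsto_metrizable_ae _ hf hlim
  have hfm (n : ℕ) : NullMeasurableSet {ω | f n ω ≤ x} P :=
    nullMeasurableSet_le (hf n) aemeasurable_const
  have hgm : NullMeasurableSet {ω | g ω ≤ x} P := nullMeasurableSet_le hg aemeasurable_const
  have hreal {A : Set Ω} (hA : NullMeasurableSet A P) :
      P.real A = ∫ ω, A.indicator (fun _ => (1 : ℝ)) ω ∂P := by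
    rw [integral_indicator₀ hA]; simp
  have hne : ∀ᵐ ω ∂P, g ω ≠ x := by rw [ae_iff]; simpa using hx
  simp_rw [hreal hgm, fun n => hreal (hfm n)]
  refine tendsto_integral_of_dominated_convergence (fun _ => 1)
    (fun n => aestronglyMeasurable_const.indicator₀ (hfm n)) (integrable_const _)
    (fun n => .of_forall fun ω => ?_) ?_
  · by_cases h : f n ω ≤ x <;> simp [Set.indicator, h]
  · filter_upwards [hlim, hne] with ω hω hne
    refine tendsto_const_nhds.congr' ?_
    rcases lt_or_gt_of_ne hne with h | h
    · filter_upwards [hω.eventually_lt_const h] with n hn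
      simp [Set.indicator, h.le, hn.le]
    · filter_upwards [hω.eventually_const_lt h] with n hn
      simp [Set.indicator, not_le.2 h, not_le.2 hn]

/-! ### The averaged price along a path -/

/-- The average `n⁻¹ ∑ exp (μ t + σ b t)` over the grid `t = 1 / n, 2 / n, …, 1`: the right Riemann
sum of the price along the noise path `b`. -/
noncomputable def averagedPrice (μ σ : ℝ) (b : ℝ≥0 → ℝ) (n : ℕ) : ℝ :=
  (n : ℝ)⁻¹ * ∑ k ∈ Finset.range n, Real.exp (μ * (((k + 1 : ℕ) : ℝ≥0) / (n : ℝ≥0) : ℝ≥0)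
    + σ * b (((k + 1 : ℕ) : ℝ≥0) / (n : ℝ≥0)))

lemma continuous_price (μ σ : ℝ) {b : ℝ≥0 → ℝ} (hb : Continuous b) :
    Continuous fun s : ℝ => Real.exp (μ * (s.toNNReal : ℝ) + σ * b s.toNNReal) := by
  have := hb.comp continuous_real_toNNReal
  fun_prop

lemma tendsto_averagedPrice (μ σ : ℝ) {b : ℝ≥0 → ℝ} (hb : Continuous b) :
    Tendsto (averagedPrice μ σ b) atTop
      (𝓝 (∫ s in (0 : ℝ)..1, Real.exp (μ * (s.toNNReal : ℝ) + σ * b s.toNNReal))) := by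
  refine (tendsto_riemannSum (continuous_price μ σ hb) (fun n k => ((k + 1 : ℕ) : ℝ) / n)
    fun n k hk => ⟨by gcongr; simp, le_rfl⟩).congr fun n => ?_
  simp only [averagedPrice]
  congr! 5 with k
  all_goals rw [Real.toNNReal_div (by positivity), Real.toNNReal_natCast, Real.toNNReal_natCast]

lemma averagedPrice_pos (μ σ : ℝ) (b : ℝ≥0 → ℝ) {n : ℕ} (hn : n ≠ 0) :
    0 < averagedPrice μ σ b n := by
  refine mul_pos (by positivity) (Finset.sum_pos (fun _ _ => Real.exp_pos _) ?_)
  simpa using hn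

lemma aemeasurable_averagedPrice {Ω : Type*} [MeasurableSpace Ω] {P : Measure Ω}
    {B : ℝ≥0 → Ω → ℝ} (hB : ∀ t, AEMeasurable (B t) P) (μ σ : ℝ) (n : ℕ) :
    AEMeasurable (fun ω => averagedPrice μ σ (B · ω) n) P := by
  unfold averagedPrice
  fun_prop

/-- The law of the averaged price depends only on the finite-dimensional distributions of the
noise. -/
lemma measure_averagedPrice_le_congr {Ω : Type*} [MeasurableSpace Ω] {P : Measure Ω}
    {B W : ℝ≥0 → Ω → ℝ} (hB : IsPreBrownianReal B P) (hW : IsPreBrownianReal W P)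
    (μ σ x : ℝ) (n : ℕ) :
    P {ω | averagedPrice μ σ (W · ω) n ≤ x} = P {ω | averagedPrice μ σ (B · ω) n ≤ x} := by
  classical
  let τ : ℕ → ℝ≥0 := fun k => ((k + 1 : ℕ) : ℝ≥0) / (n : ℝ≥0)
  let I : Finset ℝ≥0 := (Finset.range n).image τ
  have hI (k : Fin n) : τ k ∈ I := Finset.mem_image_of_mem _ (Finset.mem_range.2 k.2)
  let g : (I → ℝ) → ℝ := fun v =>
    (n : ℝ)⁻¹ * ∑ k : Fin n, Real.exp (μ * (τ k : ℝ) + σ * v ⟨τ k, hI k⟩)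
  have hg : MeasurableSet {v | g v ≤ x} := by
    refine measurableSet_le ?_ measurable_const
    fun_prop
  have key {C : ℝ≥0 → Ω → ℝ} (hC : IsPreBrownianReal C P) :
      P {ω | averagedPrice μ σ (C · ω) n ≤ x}
        = BrownianReal.projectiveFamily I {v | g v ≤ x} := by
    rw [← (hC.hasLaw I).measure_eq hg]
    congr 1
    ext ω
    simp only [averagedPrice, Finset.sum_range, g, τ, Finset.restrict]
  rw [key hB, key hW]

/-! ### Time reversal of the schedule -/

/-- On `[0, 1]` this is the time reversal `B 1 - B (1 - t)`; past `1`, where `1 - t` truncates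
to `0`, it is `B t - B 0`. -/
lemma ProbabilityTheory.IsPreBrownianReal.timeReversal {Ω : Type*} [MeasurableSpace Ω]
    {P : Measure Ω} {B : ℝ≥0 → Ω → ℝ} (hB : IsPreBrownianReal B P) :
    IsPreBrownianReal (fun t ω => B (max t 1) ω - B (1 - t) ω) P := by
  classical
  have := hB.isGaussianProcess.isProbabilityMeasure
  have hL2 (t : ℝ≥0) : MemLp (B t) 2 P := (hB.isGaussianProcess.hasGaussianLaw_eval t).memLp_two
  refine IsGaussianProcess.isPreBrownianReal_of_covariance ?_ (fun t => ?_) (fun s t hst => ?_)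
  · exact hB.isGaussianProcess.of_isGaussianProcess fun t => ⟨{max t 1, 1 - t},
      { toFun x := x ⟨max t 1, by simp⟩ - x ⟨1 - t, by simp⟩
        map_add' x y := by simp; abel
        map_smul' c x := by simp; ring }, by simp⟩
  · rw [integral_sub (hB.integrable_eval _) (hB.integrable_eval _), hB.integral_eval,
      hB.integral_eval, sub_zero]
  · rw [covariance_fun_sub_fun_sub (hL2 _) (hL2 _) (hL2 _) (hL2 _)]
    simp_rw [hB.covariance_eval]
    have h1 : max s 1 ≤ max t 1 := max_le_max_right _ hst
    have h2 (u v : ℝ≥0) : 1 - u ≤ max v 1 := tsub_le_self.trans (le_max_right _ _)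
    have h3 : 1 - t ≤ 1 - s := tsub_le_tsub_left hst _
    rw [min_eq_left h1, min_eq_right (h2 _ _), min_eq_left (h2 _ _), min_eq_right h3]
    rcases le_total s 1 with hs | hs
    · rw [max_eq_right hs, NNReal.coe_sub hs]; simp
    · rw [max_eq_left hs, tsub_eq_zero_of_le hs]; simp

lemma wealth_eq_sum {Ω : Type*} {X : ℝ≥0 → Ω → ℝ} {ω : Ω} (hX : ∀ t, X t ω ≠ 0) (c : ℕ → ℝ)
    (t : ℕ → ℝ≥0) (k : ℕ) :
    wealth X c t k ω = ∑ j ∈ Finset.range k, c j * (X (t k) ω / X (t j) ω) := by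
  induction k with
  | zero => simp [wealth]
  | succ k ih =>
    rw [wealth, ih, Finset.sum_range_succ, mul_add, Finset.mul_sum]
    congr 1
    · refine Finset.sum_congr rfl fun j _ => ?_
      have := hX (t k)
      field_simp
    · ring

/-- The return of dollar cost averaging is the averaged price along the time-reversed noise. -/
lemma dcaReturn_eq_averagedPrice {Ω : Type*} {X B : ℝ≥0 → Ω → ℝ} {μ σ : ℝ}
    (hX : ∀ t ω, X t ω = Real.exp (μ * (t : ℝ) + σ * B t ω)) {n : ℕ} (hn : n ≠ 0) (ω : Ω) :
    dcaReturn X n ω = averagedPrice μ σ (fun t => B (max t 1) ω - B (1 - t) ω) n := by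
  have hn' : (n : ℝ) ≠ 0 := by exact_mod_cast hn
  have hn'' : (n : ℝ≥0) ≠ 0 := by exact_mod_cast hn
  have hone : ∑ _j ∈ Finset.range n, 1 / (n : ℝ) = 1 := by
    simp [hn']
  rw [dcaReturn, returns, wealth_eq_sum (fun t => by rw [hX]; exact (Real.exp_pos _).ne'),
    hone, inv_one, one_mul, averagedPrice, Finset.mul_sum, ← Finset.sum_range_reflect]
  refine Finset.sum_congr rfl fun k hk => ?_
  have hk : k + 1 ≤ n := Finset.mem_range.1 hk
  have hle : ((k + 1 : ℕ) : ℝ≥0) / n ≤ 1 := by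
    rw [div_le_one (by positivity)]; exact_mod_cast hk
  have hrefl : ((n - 1 - k : ℕ) : ℝ≥0) / n = 1 - ((k + 1 : ℕ) : ℝ≥0) / n := by
    rw [eq_tsub_iff_add_eq_of_le hle, ← add_div, ← Nat.cast_add,
      show n - 1 - k + (k + 1) = n by omega, div_self hn'']
  rw [hrefl, div_self hn'', hX, hX, ← Real.exp_sub, max_eq_right hle, NNReal.coe_sub hle]
  rw [one_div]
  congr 2
  push_cast
  ring

/-! ### The integrated process has no atoms -/

/-- For a fixed noise path `b`, adding a drift `a t` to it makes the integrated price strictly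
increasing in `a`. -/
lemma strictMono_integral_price (μ : ℝ) {σ : ℝ} (hσ : 0 < σ) {b : ℝ≥0 → ℝ} (hb : Continuous b) :
    StrictMono fun a : ℝ => ∫ s in (0 : ℝ)..1,
      Real.exp (μ * (s.toNNReal : ℝ) + σ * (b s.toNNReal + s.toNNReal * a)) := by
  intro a a' haa'
  have hcont (a : ℝ) := continuous_price μ σ (b := fun t => b t + t * a) (by fun_prop)
  refine intervalIntegral.integral_lt_integral_of_continuousOn_of_le_of_exists_lt zero_lt_one
    (hcont a).continuousOn (hcont a').continuousOn (fun s _ => ?_) ⟨1, by simp, ?_⟩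
  · have := haa'.le
    gcongr
  · simpa using mul_lt_mul_of_pos_left (add_lt_add_right haa' (b 1)) hσ

/-- The integrated price has no atoms: given the bridge `B t - t B 1`, which is independent
of `B 1`, it is a strictly increasing function of `B 1`. -/
lemma measure_integral_price_eq_zero {Ω : Type*} [MeasurableSpace Ω] {P : Measure Ω}
    {B : ℝ≥0 → Ω → ℝ} (hB : IsBrownianReal B P) (μ : ℝ) {σ : ℝ} (hσ : 0 < σ) (x : ℝ) :
    P {ω | ∫ s in (0 : ℝ)..1, Real.exp (μ * (s.toNNReal : ℝ) + σ * B s.toNNReal ω) = x} = 0 := by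
  classical
  have := hB.isGaussianProcess.isProbabilityMeasure
  have hL2 (t : ℝ≥0) : MemLp (B t) 2 P := (hB.isGaussianProcess.hasGaussianLaw_eval t).memLp_two
  -- The bridge is recorded only at the countably many grid times, so that its law lives on a
  -- countable product.
  let τ : ℕ × ℕ → ℝ≥0 := fun p => min (((p.2 + 1 : ℕ) : ℝ≥0) / (p.1 : ℝ≥0)) 1
  let Y : ℕ × ℕ → Ω → ℝ := fun p ω => B (τ p) ω - τ p * B 1 ω
  let G : Unit → Ω → ℝ := fun _ => B 1
  have hYm (p : ℕ × ℕ) : AEMeasurable (Y p) P :=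
    (hB.aemeasurable _).sub ((hB.aemeasurable _).const_mul _)
  have hGm : AEMeasurable (fun ω => B 1 ω) P := hB.aemeasurable 1
  have hYm' : AEMeasurable (fun ω p => Y p ω) P := aemeasurable_pi_lambda _ hYm
  have hindep : IndepFun (fun ω p => Y p ω) (fun ω => B 1 ω) P := by
    have h := IsGaussianProcess.indepFun_of_covariance_eq_zero (X := Y) (Y := G) (P := P)
      ?_ hYm (fun _ => hB.aemeasurable 1) ?_
    · exact h.comp (φ := id) (ψ := fun v : Unit → ℝ => v ()) measurable_id (by fun_prop)
    · apply hB.isGaussianProcess.of_isGaussianProcess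
      rintro (p | _)
      · exact ⟨{τ p, 1},
          { toFun x := x ⟨τ p, by simp⟩ - τ p * x ⟨1, by simp⟩
            map_add' x y := by simp; ring
            map_smul' c x := by simp; ring }, by simp [Y]⟩
      · exact ⟨{1},
          { toFun x := x ⟨1, by simp⟩
            map_add' x y := by simp
            map_smul' c x := by simp }, by simp [G]⟩
    · intro p _
      have hτ : τ p ≤ 1 := min_le_right _ _
      simp only [Y, G]
      rw [covariance_fun_sub_left (hL2 _) ((hL2 _).const_mul _) (hL2 _),
        covariance_const_mul_left, hB.covariance_eval, hB.covariance_eval, min_eq_left hτ]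
      simp
  let S : ℕ → (ℕ × ℕ → ℝ) × ℝ → ℝ := fun n z => (n : ℝ)⁻¹ * ∑ k ∈ Finset.range n,
    Real.exp (μ * (τ (n, k) : ℝ) + σ * (z.1 (n, k) + τ (n, k) * z.2))
  have hSm (n : ℕ) : Measurable (S n) := by fun_prop
  have hS (n : ℕ) (ω : Ω) (g : ℝ) : S n (fun p => Y p ω, g)
      = averagedPrice μ σ (fun t => B t ω + t * (g - B 1 ω)) n := by
    simp only [S, averagedPrice, Y]
    congr 1
    refine Finset.sum_congr rfl fun k hk => ?_
    have hk : k + 1 ≤ n := Finset.mem_range.1 hk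
    have hle : ((k + 1 : ℕ) : ℝ≥0) / n ≤ 1 :=
      div_le_one_of_le₀ (by exact_mod_cast hk) (by positivity)
    have hτ : τ (n, k) = ((k + 1 : ℕ) : ℝ≥0) / n := min_eq_left hle
    rw [hτ]
    congr 2
    ring
  let A : Set ((ℕ × ℕ → ℝ) × ℝ) := {z | Tendsto (fun n => S n z) atTop (𝓝 x)}
  have hA : MeasurableSet A := measurableSet_tendsto _ hSm
  have hlim {ω : Ω} (hω : Continuous (B · ω)) (g : ℝ) :
      Tendsto (fun n => S n (fun p => Y p ω, g)) atTop (𝓝 (∫ s in (0 : ℝ)..1,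
        Real.exp (μ * (s.toNNReal : ℝ) + σ * (B s.toNNReal ω + s.toNNReal * (g - B 1 ω))))) := by
    simp_rw [hS]
    exact tendsto_averagedPrice μ σ (b := fun t => B t ω + t * (g - B 1 ω)) (by fun_prop)
  have hmem : {ω | ∫ s in (0 : ℝ)..1, Real.exp (μ * (s.toNNReal : ℝ) + σ * B s.toNNReal ω) = x}
      ≤ᵐ[P] (fun ω => ((fun p => Y p ω), B 1 ω)) ⁻¹' A := by
    filter_upwards [hB.cont] with ω hω h
    have := hlim hω (B 1 ω)
    simp only [sub_self, mul_zero, add_zero] at this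
    have h' : ∫ s in (0 : ℝ)..1, Real.exp (μ * (s.toNNReal : ℝ) + σ * B s.toNNReal ω) = x := h
    rwa [h'] at this
  refine measure_mono_null_ae hmem ?_
  -- By independence and Fubini it is enough that almost every section of `A` is null.
  rw [← Measure.map_apply_of_aemeasurable (hYm'.prodMk hGm) hA,
    (indepFun_iff_map_prod_eq_prod_map_map hYm' hGm).1 hindep, Measure.measure_prod_null hA,
    Filter.EventuallyEq, ae_map_iff hYm' (by
      exact measurableSet_eq_fun (measurable_measure_prodMk_left hA) measurable_const)]
  filter_upwards [hB.cont] with ω hω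
  have : NullSingletonClass (P.map fun ω => B 1 ω) := by
    rw [(hB.hasLaw_eval 1).map_eq]
    exact nullSingletonClass_gaussianReal one_ne_zero
  refine Set.Subsingleton.measure_zero ?_ _
  intro g hg g' hg'
  have hinj := (strictMono_integral_price μ hσ hω).injective
  have := hinj ((tendsto_nhds_unique (hlim hω g) hg).trans
    (tendsto_nhds_unique (hlim hω g') hg').symm)
  linarith

/-! ### The lognormal comparison variable -/

/-- A linear combination of the values of Brownian motion on the grid is Gaussian; since
`min (k / n) (l / n)` is `n⁻¹` times the number of `j` below both `k` and `l`, its variance is the mean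
square of the tail sums of the coefficients. -/
lemma ProbabilityTheory.IsPreBrownianReal.hasLaw_sum_grid {Ω : Type*} [MeasurableSpace Ω]
    {P : Measure Ω} {B : ℝ≥0 → Ω → ℝ} (hB : IsPreBrownianReal B P) (c : ℕ → ℝ) (n : ℕ) :
    HasLaw (fun ω => ∑ k ∈ Finset.range n, c k * B (((k + 1 : ℕ) : ℝ≥0) / (n : ℝ≥0)) ω)
      (gaussianReal 0
        ((n : ℝ)⁻¹ * ∑ j ∈ Finset.range n, (∑ k ∈ Finset.Ico j n, c k) ^ 2).toNNReal) P := by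
  classical
  have := hB.isGaussianProcess.isProbabilityMeasure
  set τ : ℕ → ℝ≥0 := fun k => ((k + 1 : ℕ) : ℝ≥0) / (n : ℝ≥0) with hτ
  have hproc : IsGaussianProcess (fun (k : ℕ) ω => c k * B (τ k) ω) P :=
    (hB.isGaussianProcess.comp_right τ).smul c
  have hgauss : HasGaussianLaw (fun ω => ∑ k ∈ Finset.range n, c k * B (τ k) ω) P :=
    hproc.hasGaussianLaw_fun_sum
  have hmean : ∫ ω, ∑ k ∈ Finset.range n, c k * B (τ k) ω ∂P = 0 := by
    rw [integral_finsetSum _ fun k _ => (hB.integrable_eval _).const_mul _]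
    simp [integral_const_mul, hB.integral_eval]
  have hmin : ∀ k ∈ Finset.range n, ∀ l ∈ Finset.range n, ((min (τ k) (τ l) : ℝ≥0) : ℝ)
      = (n : ℝ)⁻¹ * ∑ j ∈ Finset.range n, (if j ≤ k then 1 else 0) * (if j ≤ l then 1 else 0) := by
    intro k hk l hl
    have hk := Finset.mem_range.1 hk
    have hfilter : (Finset.range n).filter (fun j => j ≤ k ∧ j ≤ l)
        = Finset.range (min (k + 1) (l + 1)) := by
      ext j; simp only [Finset.mem_filter, Finset.mem_range]; omega
    have hcount : ∑ j ∈ Finset.range n, ((if j ≤ k then 1 else 0) * (if j ≤ l then 1 else 0) : ℝ)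
        = ((min (k + 1) (l + 1) : ℕ) : ℝ) := by
      rw [← Finset.card_range (min (k + 1) (l + 1)), ← hfilter, ← Finset.sum_boole]
      exact Finset.sum_congr rfl fun j _ => by
        by_cases h₁ : j ≤ k <;> by_cases h₂ : j ≤ l <;> simp [h₁, h₂]
    rw [hcount]
    simp only [hτ, NNReal.coe_min, NNReal.coe_div, NNReal.coe_natCast, Nat.cast_min]
    rw [min_div_div_right (by positivity), div_eq_inv_mul]
  have hvar : Var[fun ω => ∑ k ∈ Finset.range n, c k * B (τ k) ω; P]
      = (n : ℝ)⁻¹ * ∑ j ∈ Finset.range n, (∑ k ∈ Finset.Ico j n, c k) ^ 2 := by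
    rw [variance_fun_sum' fun k _ => (hproc.hasGaussianLaw_eval k).memLp_two]
    simp_rw [covariance_const_mul_left, covariance_const_mul_right, hB.covariance_fun_eval]
    have htail : ∀ j ∈ Finset.range n, ∑ k ∈ Finset.Ico j n, c k
        = ∑ k ∈ Finset.range n, c k * (if j ≤ k then 1 else 0) := by
      intro j _
      simp_rw [mul_ite, mul_one, mul_zero, ← Finset.sum_filter]
      congr 1
      ext k; simp only [Finset.mem_filter, Finset.mem_range, Finset.mem_Ico]; omega
    calc ∑ k ∈ Finset.range n, ∑ l ∈ Finset.range n, c k * (c l * ((min (τ k) (τ l) : ℝ≥0) : ℝ))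
        = ∑ k ∈ Finset.range n, ∑ l ∈ Finset.range n, ∑ j ∈ Finset.range n, (n : ℝ)⁻¹ *
            ((c k * (if j ≤ k then 1 else 0)) * (c l * (if j ≤ l then 1 else 0))) := by
          refine Finset.sum_congr rfl fun k hk => Finset.sum_congr rfl fun l hl => ?_
          rw [hmin k hk l hl, Finset.mul_sum, Finset.mul_sum, Finset.mul_sum]
          exact Finset.sum_congr rfl fun j _ => by ring
      _ = ∑ j ∈ Finset.range n, ∑ k ∈ Finset.range n, ∑ l ∈ Finset.range n, (n : ℝ)⁻¹ *
            ((c k * (if j ≤ k then 1 else 0)) * (c l * (if j ≤ l then 1 else 0))) := by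
          rw [Finset.sum_congr rfl fun k _ => Finset.sum_comm, Finset.sum_comm]
      _ = _ := by
          rw [Finset.mul_sum]
          refine Finset.sum_congr rfl fun j hj => ?_
          rw [htail j hj, sq, Finset.sum_mul_sum]
          simp_rw [Finset.mul_sum]
  refine ⟨hgauss.aemeasurable, ?_⟩
  rw [hgauss.map_eq_gaussianReal, hmean, hvar]

/-- The proportion of the total weight of the density `exp (μ s)` on `[0, 1]` that lies
in `[u, 1]`. -/
noncomputable def expTail (μ u : ℝ) : ℝ := (Real.exp μ - Real.exp (μ * u)) / (Real.exp μ - 1)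

lemma exp_sub_one_ne_zero {μ : ℝ} (hμ : μ ≠ 0) : Real.exp μ - 1 ≠ 0 :=
  sub_ne_zero.2 (Real.exp_eq_one_iff μ |>.not.2 hμ)

/-- On a uniform grid the tail proportions of the weights `exp (μ k / n)`, `1 ≤ k ≤ n`, are a ratio
of geometric sums, equal to `expTail` with no discretization error. -/
lemma sum_Ico_exp_eq {μ : ℝ} (hμ : μ ≠ 0) {n j : ℕ} (hj : j < n) :
    ∑ k ∈ Finset.Ico j n, Real.exp (μ * (((k + 1 : ℕ) : ℝ) / n))
      = expTail μ ((j : ℝ) / n) * ∑ k ∈ Finset.range n, Real.exp (μ * (((k + 1 : ℕ) : ℝ) / n)) := by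
  have hn : (n : ℝ) ≠ 0 := by exact_mod_cast (by omega : n ≠ 0)
  set q : ℝ := Real.exp (μ / n) with hq
  have hpow (k : ℕ) : Real.exp (μ * ((k : ℝ) / n)) = q ^ k := by
    rw [hq, ← Real.exp_nat_mul]; congr 1; ring
  have hqn : Real.exp μ = q ^ n := by rw [← hpow, div_self hn, mul_one]
  have hq1 : q - 1 ≠ 0 := exp_sub_one_ne_zero (div_ne_zero hμ hn)
  have hμ1 : q ^ n - 1 ≠ 0 := hqn ▸ exp_sub_one_ne_zero hμ
  have hgeom : ∀ i ≤ n, ∑ k ∈ Finset.Ico i n, q ^ (k + 1) = q * (q ^ n - q ^ i) / (q - 1) := by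
    intro i hi
    rw [mul_div_assoc, ← geom_sum_Ico (sub_ne_zero.1 hq1) hi, Finset.mul_sum]
    exact Finset.sum_congr rfl fun k _ => by ring
  simp_rw [expTail, hpow, hqn]
  rw [Finset.range_eq_Ico, hgeom j hj.le, hgeom 0 (Nat.zero_le n), pow_zero]
  field_simp

lemma continuous_expTail (μ : ℝ) : Continuous (expTail μ) := by
  unfold expTail; fun_prop

lemma integral_exp_mul_zero_one {μ : ℝ} (hμ : μ ≠ 0) :
    ∫ s in (0 : ℝ)..1, Real.exp (μ * s) = (Real.exp μ - 1) / μ := by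
  rw [intervalIntegral.integral_comp_mul_left _ hμ, integral_exp]
  simp [div_eq_inv_mul]

lemma integral_sq_expTail {μ : ℝ} (hμ : μ ≠ 0) (σ : ℝ) :
    ∫ u in (0 : ℝ)..1, (σ * expTail μ u) ^ 2 = boundLogVariance μ σ := by
  have hμ1 := exp_sub_one_ne_zero hμ
  have hderiv : ∀ u ∈ Set.uIcc (0 : ℝ) 1, HasDerivAt
      (fun u => σ ^ 2 / (Real.exp μ - 1) ^ 2 * (Real.exp μ ^ 2 * u
        - 2 * Real.exp μ / μ * Real.exp (μ * u) + 1 / (2 * μ) * Real.exp (μ * u) ^ 2))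
      ((σ * expTail μ u) ^ 2) u := by
    intro u _
    have he : HasDerivAt (fun u => Real.exp (μ * u)) (Real.exp (μ * u) * μ) u := by
      simpa using ((hasDerivAt_id u).const_mul μ).exp
    refine (((((hasDerivAt_id' u).const_mul (Real.exp μ ^ 2)).fun_sub
      (he.const_mul (2 * Real.exp μ / μ))).fun_add ((he.fun_pow 2).const_mul
        (1 / (2 * μ)))).const_mul (σ ^ 2 / (Real.exp μ - 1) ^ 2)).congr_deriv ?_
    rw [expTail]
    field_simp
    ring
  rw [intervalIntegral.integral_eq_sub_of_hasDerivAt hderiv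
    (((continuous_expTail μ).const_mul σ |>.pow 2).intervalIntegrable _ _), boundLogVariance,
    show 2 * μ = μ + μ by ring, Real.exp_add]
  simp only [mul_one, mul_zero, Real.exp_zero]
  field_simp
  ring

lemma boundLogVariance_pos {μ σ : ℝ} (hμ : μ ≠ 0) (hσ : 0 < σ) : 0 < boundLogVariance μ σ := by
  rw [← integral_sq_expTail hμ]
  refine intervalIntegral.intervalIntegral_pos_of_pos_on
    (((continuous_expTail μ).const_mul σ |>.pow 2).intervalIntegrable _ _) (fun u hu => ?_)
    zero_lt_one
  have hne : expTail μ u ≠ 0 := by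
    refine div_ne_zero (sub_ne_zero.2 fun h => ?_) (exp_sub_one_ne_zero hμ)
    have h : μ * 1 = μ * u := by rw [mul_one]; exact Real.exp_injective h
    exact hu.2.ne' (mul_left_cancel₀ hμ h)
  positivity

/-- Jensen's inequality: the averaged price dominates the geometric mean of the prices with weights
proportional to `exp (μ t)`, rescaled by the averaged price of the noiseless path. -/
lemma exp_le_averagedPrice (μ σ : ℝ) (b : ℝ≥0 → ℝ) {n : ℕ} (hn : n ≠ 0) {D : ℝ}
    (hD : D = ∑ k ∈ Finset.range n, Real.exp (μ * (((k + 1 : ℕ) : ℝ) / n))) :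
    Real.exp (Real.log ((n : ℝ)⁻¹ * D) + ∑ k ∈ Finset.range n,
      σ * (Real.exp (μ * (((k + 1 : ℕ) : ℝ) / n)) / D) * b (((k + 1 : ℕ) : ℝ≥0) / (n : ℝ≥0)))
      ≤ averagedPrice μ σ b n := by
  have hD0 : 0 < D := by
    rw [hD]
    exact Finset.sum_pos (fun _ _ => Real.exp_pos _) (by simpa using hn)
  have hjensen := convexOn_exp.map_sum_le (t := Finset.range n)
    (w := fun k => Real.exp (μ * (((k + 1 : ℕ) : ℝ) / n)) / D)
    (p := fun k => σ * b (((k + 1 : ℕ) : ℝ≥0) / (n : ℝ≥0))) (fun k _ => by positivity)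
    (by rw [← Finset.sum_div, ← hD, div_self hD0.ne']) (fun _ _ => Set.mem_univ _)
  rw [Real.exp_add, Real.exp_log (by positivity), averagedPrice, mul_assoc]
  refine mul_le_mul_of_nonneg_left ?_ (by positivity)
  calc D * Real.exp (∑ k ∈ Finset.range n, σ * (Real.exp (μ * (((k + 1 : ℕ) : ℝ) / n)) / D)
        * b (((k + 1 : ℕ) : ℝ≥0) / (n : ℝ≥0)))
      = D * Real.exp (∑ k ∈ Finset.range n, (Real.exp (μ * (((k + 1 : ℕ) : ℝ) / n)) / D)
        • (σ * b (((k + 1 : ℕ) : ℝ≥0) / (n : ℝ≥0)))) := by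
        congr 2
        exact Finset.sum_congr rfl fun k _ => by rw [smul_eq_mul]; ring
    _ ≤ _ := mul_le_mul_of_nonneg_left hjensen hD0.le
    _ = _ := by
        rw [Finset.mul_sum]
        refine Finset.sum_congr rfl fun k _ => ?_
        rw [Real.exp_add, smul_eq_mul]
        push_cast
        field_simp

lemma gaussianReal_real_le (m : ℝ) (v : ℝ≥0) (y : ℝ) :
    (gaussianReal m v).real {z | z ≤ y} = (gaussianReal 0 1).real {z | m + √v * z ≤ y} := by
  have hmap : (gaussianReal 0 1).map (fun z => m + √v * z) = gaussianReal m v := by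
    rw [← Function.comp_def (fun z => m + z) (fun z => √v * z),
      ← Measure.map_map (by fun_prop) (by fun_prop), gaussianReal_map_const_mul,
      gaussianReal_map_const_add]
    congr 1
    · simp
    · ext; simp
  rw [← hmap, map_measureReal_apply (by fun_prop) (s := {z | z ≤ y}) measurableSet_Iic]
  rfl

/-- Gaussian distribution functions depend continuously on the mean and on the variance, as long as
the limiting variance is positive. -/
lemma tendsto_gaussianReal_le {m : ℕ → ℝ} {v : ℕ → ℝ≥0} {m₀ : ℝ} {v₀ : ℝ≥0} (hv₀ : v₀ ≠ 0)
    (hm : Tendsto m atTop (𝓝 m₀)) (hv : Tendsto v atTop (𝓝 v₀)) (y : ℝ) :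
    Tendsto (fun n => (gaussianReal (m n) (v n)).real {z | z ≤ y}) atTop
      (𝓝 ((gaussianReal m₀ v₀).real {z | z ≤ y})) := by
  simp_rw [gaussianReal_real_le]
  refine tendsto_measureReal_le_of_ae_tendsto (fun n => by fun_prop) (.of_forall fun z => ?_) ?_
  · have : Tendsto (fun n => √(v n)) atTop (𝓝 √v₀) :=
      (Real.continuous_sqrt.tendsto _).comp ((NNReal.continuous_coe.tendsto _).comp hv)
    exact hm.add (this.mul_const z)
  · have := nullSingletonClass_gaussianReal (μ := 0) one_ne_zero
    refine Set.Subsingleton.measure_zero (fun z hz z' hz' => ?_) _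
    have hpos : 0 < √(v₀ : ℝ) := Real.sqrt_pos.2 (by positivity)
    exact mul_left_cancel₀ hpos.ne' (add_left_cancel (hz.trans hz'.symm))

/-- The distribution function of the averaged price is bounded by that of a lognormal variable whose
parameters converge to those of the comparison variable. -/
lemma exists_gaussianReal_bound {Ω : Type*} [MeasurableSpace Ω] {P : Measure Ω}
    {B : ℝ≥0 → Ω → ℝ} (hB : IsPreBrownianReal B P) {μ : ℝ} (hμ : μ ≠ 0) (σ : ℝ) :
    ∃ (m : ℕ → ℝ) (v : ℕ → ℝ≥0), Tendsto m atTop (𝓝 (boundLogMean μ)) ∧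
      Tendsto v atTop (𝓝 (boundLogVariance μ σ).toNNReal) ∧
      ∀ n ≠ 0, ∀ x > 0, P.real {ω | averagedPrice μ σ (B · ω) n ≤ x}
        ≤ (gaussianReal (m n) (v n)).real {z | z ≤ Real.log x} := by
  have := hB.isGaussianProcess.isProbabilityMeasure
  let D : ℕ → ℝ := fun n => ∑ k ∈ Finset.range n, Real.exp (μ * (((k + 1 : ℕ) : ℝ) / n))
  refine ⟨fun n => Real.log ((n : ℝ)⁻¹ * D n), fun n => ((n : ℝ)⁻¹ * ∑ j ∈ Finset.range n,
    (σ * expTail μ ((j : ℝ) / n)) ^ 2).toNNReal, ?_, ?_, fun n hn x hx => ?_⟩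
  · have hlim := tendsto_riemannSum (f := fun s => Real.exp (μ * s)) (by fun_prop)
      (fun n k => ((k + 1 : ℕ) : ℝ) / n) fun n k _ => ⟨by gcongr; simp, le_rfl⟩
    rw [integral_exp_mul_zero_one hμ] at hlim
    refine hlim.log (div_ne_zero (exp_sub_one_ne_zero hμ) hμ)
  · have hlim := tendsto_riemannSum (f := fun s => (σ * expTail μ s) ^ 2)
      ((continuous_expTail μ).const_mul σ |>.pow 2) (fun n k => (k : ℝ) / n)
      fun n k _ => ⟨le_rfl, by gcongr; simp⟩
    rw [integral_sq_expTail hμ] at hlim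
    exact (continuous_real_toNNReal.tendsto _).comp hlim
  · have hD0 : D n ≠ 0 :=
      (Finset.sum_pos (fun _ _ => Real.exp_pos _) (by simpa using hn)).ne'
    have hlaw := hB.hasLaw_sum_grid
      (fun k => σ * (Real.exp (μ * (((k + 1 : ℕ) : ℝ) / n)) / D n)) n
    have hv : ∑ j ∈ Finset.range n,
        (∑ k ∈ Finset.Ico j n, σ * (Real.exp (μ * (((k + 1 : ℕ) : ℝ) / n)) / D n)) ^ 2
        = ∑ j ∈ Finset.range n, (σ * expTail μ ((j : ℝ) / n)) ^ 2 := by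
      refine Finset.sum_congr rfl fun j hj => ?_
      rw [← Finset.mul_sum, ← Finset.sum_div, sum_Ico_exp_eq hμ (Finset.mem_range.1 hj),
        mul_div_assoc, div_self hD0, mul_one]
    rw [hv] at hlaw
    have hlaw' := gaussianReal_const_add hlaw (Real.log ((n : ℝ)⁻¹ * D n))
    rw [zero_add] at hlaw'
    rw [measureReal_def, measureReal_def, ← hlaw'.measure_eq measurableSet_Iic]
    refine ENNReal.toReal_mono (measure_ne_top _ _) (measure_mono fun ω hω => ?_)
    exact (Real.le_log_iff_exp_le hx).2
      ((exp_le_averagedPrice μ σ (B · ω) hn rfl).trans hω)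

/-- Positive variables have the distribution function given by the law of their logarithm. -/
lemma measureReal_le_eq_of_hasLaw_log {Ω : Type*} [MeasurableSpace Ω] {P : Measure Ω} {Z : Ω → ℝ}
    (hZpos : ∀ᵐ ω ∂P, 0 < Z ω) {ν : Measure ℝ} (hZ : HasLaw (fun ω => Real.log (Z ω)) ν P)
    {x : ℝ} (hx : 0 < x) : P.real {ω | Z ω ≤ x} = ν.real {z | z ≤ Real.log x} := by
  rw [measureReal_def, measureReal_def, ← hZ.measure_eq measurableSet_Iic]
  congr 1
  refine measure_congr ?_
  filter_upwards [hZpos] with ω hω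
  exact propext (Real.log_le_log_iff hω hx).symm

/-! ### The limit and the bound -/

theorem mainTheorem3 {Ω Ω' : Type*} [MeasurableSpace Ω] [MeasurableSpace Ω']
    (P : Measure Ω) [IsProbabilityMeasure P] (P' : Measure Ω') [IsProbabilityMeasure P']
    (μ σ : ℝ) (hμ : μ ≠ 0) (hσ : 0 < σ)
    (X : ℝ≥0 → Ω → ℝ) (hX : IsGeometricBrownianMotion X μ σ P)
    (Z : Ω' → ℝ) (hZpos : ∀ᵐ ω ∂P', 0 < Z ω)
    (hZ : HasLaw (fun ω => Real.log (Z ω))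
      (gaussianReal (boundLogMean μ) (boundLogVariance μ σ).toNNReal) P') :
    0 < boundLogVariance μ σ ∧
    ∀ x : ℝ,
      Tendsto (fun n : ℕ => P.real {ω | dcaReturn X n ω ≤ x}) atTop
        (𝓝 (P.real {ω | integratedProcess X ω ≤ x})) ∧
      P'.real {ω | Z ω ≤ x} ≥ P.real {ω | integratedProcess X ω ≤ x} := by
  obtain ⟨B, hB, hXB⟩ := hX
  have hpre := hB.toIsPreBrownianReal
  have hvar := boundLogVariance_pos hμ hσ
  have hint : integratedProcess X = fun ω => ∫ s in (0 : ℝ)..1,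
      Real.exp (μ * (s.toNNReal : ℝ) + σ * B s.toNNReal ω) := by
    funext ω; simp only [integratedProcess, hXB]
  refine ⟨hvar, fun x => ?_⟩
  have hlim : Tendsto (fun n : ℕ => P.real {ω | averagedPrice μ σ (B · ω) n ≤ x}) atTop
      (𝓝 (P.real {ω | integratedProcess X ω ≤ x})) := by
    refine tendsto_measureReal_le_of_ae_tendsto
      (aemeasurable_averagedPrice hpre.aemeasurable μ σ) ?_ ?_
    · filter_upwards [hB.cont] with ω hω
      rw [hint]
      exact tendsto_averagedPrice μ σ hω
    · rw [hint]
      exact measure_integral_price_eq_zero hB μ hσ x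
  refine ⟨hlim.congr' ?_, ?_⟩
  · filter_upwards [eventually_ne_atTop 0] with n hn
    simp_rw [dcaReturn_eq_averagedPrice hXB hn, measureReal_def,
      measure_averagedPrice_le_congr hpre hpre.timeReversal]
  rcases le_or_gt x 0 with hx | hx
  -- For `x ≤ 0` there is nothing to compare: the averaged prices are positive.
  · refine le_of_tendsto' (hlim.congr' (f₂ := fun _ => (0 : ℝ)) ?_) fun _ => measureReal_nonneg
    filter_upwards [eventually_ne_atTop 0] with n hn
    simp [fun ω => (hx.trans_lt (averagedPrice_pos μ σ (B · ω) hn)).not_ge]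
  · obtain ⟨m, v, hm, hv, hbound⟩ := exists_gaussianReal_bound hpre hμ σ
    rw [measureReal_le_eq_of_hasLaw_log hZpos hZ hx]
    refine le_of_tendsto_of_tendsto hlim
      (tendsto_gaussianReal_le (Real.toNNReal_pos.2 hvar).ne' hm hv _) ?_
    filter_upwards [eventually_ne_atTop 0] with n hn
    exact hbound n hn x hx
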